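/- Conventions. Everything is over $\mathbb R$ and in the super ($\mathbb Z/2$-graded) sense; $\tilde a$ is the parity of $a$ and $(-1)^a$ means $(-1)^{\tilde a}$. A symplectic $2$-manifold $\mathcal M$ is a supermanifold (with underlying smooth manifold $X$) with a grading of its functions by weight, having local coordinates of weights $0,1,2$ and functions polynomial in the coordinates of positive weight, together with a weight $2$ even symplectic structure, given by its Poisson bracket: an even, non-degenerate Poisson bracket $[-,-]$ of weight $-2$ on functions. Let $\mathcal A=\bigoplus_{k\ge 0}\mathcal A^k$ be its algebra of functions, and let $E$ be the corresponding pseudo-Euclidean vector bundle: its space of sections $\Gamma(E)$ comes with an odd isomorphism $\chi:\Gamma(E)\to\mathcal A^1$, $u\mapsto\chi_u$ (with $\chi_{fu}=(-1)^f f\chi_u$ for $f\in\mathcal A^0$), and with the bilinear form $g(u,v)=(-1)^u[\chi_u,\chi_v]$. Let $P:\mathcal A\to\mathcal A^0\oplus\mathcal A^1$ be the projector onto weights $0$ and $1$. For a linear map $D:\mathcal A\to\mathcal A$ the $k$th derived Dorfman bracket generated by $D$, $k\ge1$, is the multilinear operation $d_k^D:\Gamma(E)^{\times k}\to\Gamma(E)$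 given on homogeneous sections by $$\chi\big(d^D_k(u_1,\dots,u_k)\big)=(-1)^{(k-1)u_1+(k-2)u_2+\cdots+u_{k-1}}\Big(P[\cdots[D\chi_{u_1},\chi_{u_2}],\dots,\chi_{u_k}]-[P[\cdots[D\chi_{u_1},\chi_{u_2}],\dots,\chi_{u_{k-1}}],\chi_{u_k}]\Big),$$ where for $k=1$ the right-hand side is $PD\chi_{u_1}$. Multilinear operations $l_k$, $k\ge 1$, of parity $k \bmod 2$ on a super vector space $V$ form a homotopy Loday algebra if for all $n\ge1$ and all homogeneous $v_1,\dots,v_n$ the expression $$J_n(v_1,\dots,v_n)=\sum_{i+j=n+1}\ \sum_{k=j}^{n}\ \sum_{\sigma\in Sh(k-j,j-1)}K(\sigma)(-1)^{(n-k+1)(j-1)}(-1)^{j(v_{\sigma(1)}+\cdots+v_{\sigma(k-j)})}\,l_i\big(v_{\sigma(1)},\dots,v_{\sigma(k-j)},l_j(v_{\sigma(k-j+1)},\dots,v_{\sigma(k-1)},v_k),v_{k+1},\dots,v_n\big)$$ vanishes; here $i,j\ge1$, $Sh(k-j,j-1)$ is the set of $(k-j,j-1)$-unshuffles of $\{1,\dots,k-1\}$,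 and $K(\sigma)$ is the product of the sign of $\sigma$ and the Koszul sign of permuting $v_1,\dots,v_{k-1}$. Theorem. Let $\theta\in\mathcal A$ be odd with $P\theta=0$ and let $Q=[\theta,-]$. Then the formula above defines brackets $d_k=d_k^Q$ and $d_k^{Q^2}$ for all $k\ge1$ (that is, for $D=Q$ and for $D=Q^2$ its right-hand side lies in $\mathcal A^1$), and for all $n\ge1$ and all homogeneous $u_1,\dots,u_n\in\Gamma(E)$ the expression $J_n$ formed with $l_k=d_k$ satisfies $$J_n(u_1,\dots,u_n)=(-1)^{n+1}\,d_n^{Q^2}(u_1,\dots,u_n).$$ In particular, if $Q^2=0$, then the operations $d_1,d_2,d_3,\dots$ make $\Gamma(E)$ a homotopy Loday algebra. The binary operation is the Dorfman bracket generated by the weight $3$ component $\theta_3$ of $\theta$: $\chi(d_2(u,v))=(-1)^u[[\theta_3,\chi_u],\chi_v]$ for $u,v\in\Gamma(E)$ with $u$ homogeneous. -/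

import Mathlib

open scoped Manifold ContDiff
open TopologicalSpace

namespace HigherDorfman

universe u v w

/-- The sign `(-1)^s` of a parity `s`. -/
def sgn (s : ZMod 2) : ℝ := (-1) ^ s.val

/-! ### Weighted Poisson superalgebras -/

section Algebra

variable {A : Type v} [Ring A] [Algebra ℝ A]

/-- A weight grading and a parity grading on `A` that are compatible with each other and for
which `A` is commutative in the super sense. -/
structure IsWeightedSuperalgebra (wt : ℕ → Submodule ℝ A) [GradedAlgebra wt]
    (par : ZMod 2 → Submodule ℝ A) [GradedAlgebra par] : Prop where
  proj_mem_par : ∀ (k : ℕ) (s : ZMod 2) (f : A), f ∈ par s → GradedAlgebra.proj wt k f ∈ par s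
  super_comm : ∀ (s t : ZMod 2) (f g : A), f ∈ par s → g ∈ par t → f * g = sgn (s * t) • (g * f)

/-- An even Poisson bracket of weight `-2`. -/
structure IsWeightTwoPoisson (wt : ℕ → Submodule ℝ A) (par : ZMod 2 → Submodule ℝ A)
    (br : A →ₗ[ℝ] A →ₗ[ℝ] A) : Prop where
  par_mem : ∀ (s t : ZMod 2) (f g : A), f ∈ par s → g ∈ par t → br f g ∈ par (s + t)
  wt_mem : ∀ (k l m : ℕ) (f g : A), f ∈ wt k → g ∈ wt l → m + 2 = k + l → br f g ∈ wt m
  wt_neg : ∀ (k l : ℕ) (f g : A), f ∈ wt k → g ∈ wt l → k + l < 2 → br f g = 0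
  super_skew : ∀ (s t : ZMod 2) (f g : A), f ∈ par s → g ∈ par t →
    br f g = -(sgn (s * t) • br g f)
  leibniz : ∀ (s t : ZMod 2) (f g h : A), f ∈ par s → g ∈ par t →
    br f (g * h) = br f g * h + sgn (s * t) • (g * br f h)
  jacobi : ∀ (s t : ZMod 2) (f g h : A), f ∈ par s → g ∈ par t →
    br f (br g h) = br (br f g) h + sgn (s * t) • br g (br f h)

/-- The projector onto weights `0` and `1`. -/
noncomputable def projP (wt : ℕ → Submodule ℝ A) [GradedAlgebra wt] : A →ₗ[ℝ] A :=
  GradedAlgebra.proj wt 0 + GradedAlgebra.proj wt 1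

/-- The component of weight `1`, as an element of that component. -/
noncomputable def toWeightOne (wt : ℕ → Submodule ℝ A) [GradedAlgebra wt] : A →ₗ[ℝ] wt 1 :=
  (DirectSum.component ℝ ℕ (fun k => wt k) 1) ∘ₗ
    (DirectSum.decomposeLinearEquiv wt).toLinearMap

/-- `(a₁, …, aₖ₊₁) ↦ [⋯[D a₁, a₂], …, aₖ₊₁]`. -/
noncomputable def nested (br : A →ₗ[ℝ] A →ₗ[ℝ] A) (D : A →ₗ[ℝ] A) :
    (k : ℕ) → MultilinearMap ℝ (fun _ : Fin (k + 1) => A) A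
  | 0 => MultilinearMap.ofSubsingleton ℝ A A (0 : Fin 1) D
  | k + 1 => (br.compMultilinearMap (nested br D k)).uncurryRight

/-- `(a₁, …, aₖ₊₁) ↦ P[⋯[D a₁, a₂], …, aₖ₊₁] - [P[⋯[D a₁, a₂], …, aₖ], aₖ₊₁]`, which is
`P (D a₁)` for a single argument. -/
noncomputable def derivedForm (wt : ℕ → Submodule ℝ A) [GradedAlgebra wt]
    (br : A →ₗ[ℝ] A →ₗ[ℝ] A) (D : A →ₗ[ℝ] A) :
    (k : ℕ) → MultilinearMap ℝ (fun _ : Fin (k + 1) => A) A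
  | 0 => (projP wt).compMultilinearMap (nested br D 0)
  | k + 1 => (projP wt).compMultilinearMap (nested br D (k + 1)) -
      ((br ∘ₗ projP wt).compMultilinearMap (nested br D k)).uncurryRight

end Algebra

/-! ### Homotopy Loday algebras -/

section Loday

variable {V : Type w} [AddCommGroup V] [Module ℝ V]

/-- Apply the operation of the right arity to a list of arguments. -/
def apply (l : (k : ℕ) → MultilinearMap ℝ (fun _ : Fin k => V) V) (L : List V) : V :=
  l L.length L.get

/-- The `(a, m - a)`-unshuffles. -/
def unshuffles (a m : ℕ) : Finset (Equiv.Perm (Fin m)) :=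
  {σ | ∀ x y : Fin m, x < y → ((y : ℕ) < a ∨ a ≤ (x : ℕ)) → σ x < σ y}

/-- The Koszul sign `κ(σ)` of `v₁ ⋯ vₘ = κ(σ) v_{σ(1)} ⋯ v_{σ(m)}`, for `vₓ` of parity `q x`. -/
def koszulSign {m : ℕ} (q : Fin m → ZMod 2) (σ : Equiv.Perm (Fin m)) : ℝ :=
  ∏ x : Fin m, ∏ y : Fin m, if x < y ∧ σ y < σ x then sgn (q (σ x) * q (σ y)) else 1

/-- The left-hand side `Jₙ(v₁, …, vₙ)` of the `n`th homotopy Loday identity, for homogeneous `vₓ`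
of parity `q x`. In the usual numbering from `1`, the summation variable `c` stands for `k - 1`
(so `v c` is `vₖ`), `b` for `j - 1` and `i = n + 1 - j`; the sign is
`sgn(σ) κ(σ) (-1)^{(n-k+1)(j-1)} (-1)^{j(v_{σ(1)} + ⋯ + v_{σ(k-j)})}`. -/
def lodayJ (l : (k : ℕ) → MultilinearMap ℝ (fun _ : Fin k => V) V) {n : ℕ}
    (q : Fin n → ZMod 2) (v : Fin n → V) : V :=
  ∑ c : Fin n, ∑ b ∈ Finset.range ((c : ℕ) + 1), ∑ σ ∈ unshuffles ((c : ℕ) - b) (c : ℕ),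
    (((Equiv.Perm.sign σ : ℤ) : ℝ) *
      koszulSign (fun x : Fin c => q (x.castLE c.isLt.le)) σ *
      (-1) ^ ((n - (c : ℕ)) * b) *
      sgn (((b + 1 : ℕ) : ZMod 2) *
        ∑ x : Fin c, if (x : ℕ) < (c : ℕ) - b then q ((σ x).castLE c.isLt.le) else 0)) •
    apply l
      ((List.ofFn fun x : Fin c => v ((σ x).castLE c.isLt.le)).take ((c : ℕ) - b) ++
        [apply l ((List.ofFn fun x : Fin c => v ((σ x).castLE c.isLt.le)).drop ((c : ℕ) - b) ++
          [v c])] ++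
        (List.ofFn v).drop ((c : ℕ) + 1))

/-- Operations `l₁, l₂, …` on the super vector space `V` form a homotopy Loday algebra: `lₖ` has
parity `k mod 2`, and all the homotopy Loday identities hold. -/
structure IsHomotopyLoday (par : ZMod 2 → Submodule ℝ V)
    (l : (k : ℕ) → MultilinearMap ℝ (fun _ : Fin k => V) V) : Prop where
  parity : ∀ (k : ℕ), 1 ≤ k → ∀ (q : Fin k → ZMod 2) (v : Fin k → V), (∀ x, v x ∈ par (q x)) →
    l k v ∈ par ((k : ZMod 2) + ∑ x, q x)
  identity : ∀ (n : ℕ), 1 ≤ n → ∀ (q : Fin n → ZMod 2) (v : Fin n → V), (∀ x, v x ∈ par (q x)) →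
    lodayJ l q v = 0

/-- The linear involution equal to `(-1)^s` on vectors of parity `s`. -/
noncomputable def parityInvolution (par : ZMod 2 → Submodule ℝ V) [DirectSum.Decomposition par] :
    V →ₗ[ℝ] V :=
  ∑ s : ZMod 2, sgn s • ((par s).subtype ∘ₗ (DirectSum.component ℝ (ZMod 2) (fun t => par t) s) ∘ₗ
    (DirectSum.decomposeLinearEquiv par).toLinearMap)

end Loday

/-! ### Symplectic 2-manifolds -/

/-- A presheaf of weighted superalgebras on `X` whose components of each weight are sheaves. -/
structure WeightedSheaf (X : Type u) [TopologicalSpace X] where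
  F : Opens X → Type v
  [ring : ∀ U, Ring (F U)]
  [algebra : ∀ U, Algebra ℝ (F U)]
  wt : ∀ U, ℕ → Submodule ℝ (F U)
  [wtGraded : ∀ U, GradedAlgebra (wt U)]
  par : ∀ U, ZMod 2 → Submodule ℝ (F U)
  [parGraded : ∀ U, GradedAlgebra (par U)]
  super : ∀ U, IsWeightedSuperalgebra (wt U) (par U)
  res : ∀ {U W : Opens X}, W ≤ U → F U →ₐ[ℝ] F W
  res_self : ∀ (U : Opens X) (f : F U), res le_rfl f = f
  res_res : ∀ {U W W' : Opens X} (h : W ≤ U) (h' : W' ≤ W) (f : F U),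
    res h' (res h f) = res (h'.trans h) f
  res_wt : ∀ {U W : Opens X} (h : W ≤ U) (k : ℕ) (f : F U), f ∈ wt U k → res h f ∈ wt W k
  res_par : ∀ {U W : Opens X} (h : W ≤ U) (s : ZMod 2) (f : F U), f ∈ par U s → res h f ∈ par W s
  glue : ∀ (k : ℕ) {ι : Type u} (U : ι → Opens X) (f : ∀ i, F (U i)), (∀ i, f i ∈ wt (U i) k) →
    (∀ i j, res (inf_le_left : U i ⊓ U j ≤ U i) (f i) = res inf_le_right (f j)) →
    ∃! g : F (⨆ i, U i), g ∈ wt (⨆ i, U i) k ∧ ∀ i, res (le_iSup U i) g = f i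

attribute [instance] WeightedSheaf.ring WeightedSheaf.algebra WeightedSheaf.wtGraded
  WeightedSheaf.parGraded

section Manifold

variable {p : ℕ} {X : Type u} [TopologicalSpace X] [ChartedSpace (EuclideanSpace ℝ (Fin p)) X]

/-- Local coordinates `(x₁, …, xₚ; y₁, …, yₙ)` on an open set `U`. The `xₐ` are coordinates of the
underlying manifold, lifted to even functions of weight `0` by an embedding `σ` of the smooth
functions. The `yᵢ` have weights `0`, `1`, `2` and any parity, but are odd if the weight is `0`.
Every function is in exactly one way a polynomial in the `yᵢ`, with smooth coefficients and with
the odd `yᵢ` occurring to power at most `1`. -/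
structure Coordinates (𝓞 : WeightedSheaf.{u, v} X) (U : Opens X) where
  e : OpenPartialHomeomorph X (EuclideanSpace ℝ (Fin p))
  e_mem : e ∈ IsManifold.maximalAtlas (𝓡 p) ∞ X
  subset_source : (U : Set X) ⊆ e.source
  x : Fin p → C^∞⟮𝓡 p, U; ℝ⟯
  x_eq : ∀ (a : Fin p) (z : U), x a z = e z a
  σ : ∀ W : Opens X, W ≤ U → C^∞⟮𝓡 p, W; ℝ⟯ →ₐ[ℝ] 𝓞.F W
  σ_wt : ∀ W h f, σ W h f ∈ 𝓞.wt W 0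
  σ_par : ∀ W h f, σ W h f ∈ 𝓞.par W 0
  σ_res : ∀ (W W' : Opens X) (h : W ≤ U) (h' : W' ≤ W) (f : C^∞⟮𝓡 p, W; ℝ⟯),
    𝓞.res h' (σ W h f) =
      σ W' (h'.trans h) (ContMDiffMap.restrictRingHom (𝓡 p) 𝓘(ℝ, ℝ) ℝ h' f)
  n : ℕ
  weight : Fin n → ℕ
  weight_le : ∀ i, weight i ≤ 2
  parity : Fin n → ZMod 2
  parity_eq_one : ∀ i, weight i = 0 → parity i = 1
  y : Fin n → 𝓞.F U
  y_wt : ∀ i, y i ∈ 𝓞.wt U (weight i)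
  y_par : ∀ i, y i ∈ 𝓞.par U (parity i)
  polynomial : ∀ (W : Opens X) (h : W ≤ U), Function.Bijective
    fun c : {m : Fin n → ℕ // ∀ i, parity i = 1 → m i ≤ 1} →₀ C^∞⟮𝓡 p, W; ℝ⟯ =>
      c.sum fun m f => σ W h f * 𝓞.res h (List.ofFn fun i => y i ^ m.1 i).prod

/-- All the coordinates, as functions on `U`. -/
noncomputable def Coordinates.z {𝓞 : WeightedSheaf.{u, v} X} {U : Opens X} (c : Coordinates (p := p) 𝓞 U) :
    Fin p ⊕ Fin c.n → 𝓞.F U :=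
  Sum.elim (fun a => c.σ U le_rfl (c.x a)) c.y

variable (p X) in
/-- A symplectic 2-manifold with underlying smooth manifold `X` of dimension `p`: a supermanifold
with functions of non-negative weight, locally with coordinates of weights `0`, `1`, `2`, and with
a symplectic structure of weight `2`, given by its Poisson bracket: an even Poisson bracket of
weight `-2` which is non-degenerate, that is, has an invertible matrix in local coordinates. -/
structure SymplecticTwoManifold extends WeightedSheaf.{u, v} X where
  coordinates : ∀ x : X, ∃ U : Opens X, x ∈ U ∧ Nonempty (Coordinates (p := p) toWeightedSheaf U)
  br : ∀ U, F U →ₗ[ℝ] F U →ₗ[ℝ] F U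
  br_res : ∀ {U W : Opens X} (h : W ≤ U) (f g : F U), res h (br U f g) = br W (res h f) (res h g)
  poisson : ∀ U, IsWeightTwoPoisson (wt U) (par U) (br U)
  nondegenerate : ∀ (U : Opens X) (c : Coordinates (p := p) toWeightedSheaf U),
    IsUnit (Matrix.of fun a b => br U (c.z a) (c.z b))

namespace SymplecticTwoManifold

/-- The algebra of functions. -/
abbrev A (𝓜 : SymplecticTwoManifold.{u, v} p X) : Type v := 𝓜.F ⊤

/-- The functions of weight `k`. -/
abbrev Wt (𝓜 : SymplecticTwoManifold.{u, v} p X) (k : ℕ) : Submodule ℝ 𝓜.A := 𝓜.wt ⊤ k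

/-- The functions of parity `s`. -/
abbrev Par (𝓜 : SymplecticTwoManifold.{u, v} p X) (s : ZMod 2) : Submodule ℝ 𝓜.A := 𝓜.par ⊤ s

/-- The Poisson bracket of functions. -/
abbrev bracket (𝓜 : SymplecticTwoManifold.{u, v} p X) : 𝓜.A →ₗ[ℝ] 𝓜.A →ₗ[ℝ] 𝓜.A := 𝓜.br ⊤

/-- The projector onto functions of weights `0` and `1`. -/
noncomputable abbrev P (𝓜 : SymplecticTwoManifold.{u, v} p X) : 𝓜.A →ₗ[ℝ] 𝓜.A :=
  projP (𝓜.wt ⊤)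

end SymplecticTwoManifold

/-- The super vector space `Γ(E)` of sections of the pseudo-Euclidean vector bundle `E` that
corresponds to `𝓜`: a module over the functions of weight `0`, with the bilinear form `g` and with
the odd isomorphism `χ` onto the functions of weight `1`. -/
structure Sections (𝓜 : SymplecticTwoManifold.{u, v} p X) where
  V : Type w
  [addCommGroup : AddCommGroup V]
  [moduleReal : Module ℝ V]
  [module : Module (𝓜.Wt 0) V]
  par : ZMod 2 → Submodule ℝ V
  [decomposition : DirectSum.Decomposition par]
  χ : V ≃ₗ[ℝ] 𝓜.Wt 1
  χ_odd : ∀ (s : ZMod 2) (u : V), u ∈ par s → (χ u : 𝓜.A) ∈ 𝓜.Par (s + 1)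
  χ_smul : ∀ (s : ZMod 2) (f : 𝓜.Wt 0) (u : V), (f : 𝓜.A) ∈ 𝓜.Par s →
    (χ (f • u) : 𝓜.A) = sgn s • ((f : 𝓜.A) * χ u)
  g : V →ₗ[ℝ] V →ₗ[ℝ] 𝓜.Wt 0
  g_eq : ∀ (s : ZMod 2) (u v : V), u ∈ par s →
    (g u v : 𝓜.A) = sgn s • 𝓜.bracket (χ u) (χ v)

attribute [instance] Sections.addCommGroup Sections.moduleReal Sections.module
  Sections.decomposition

namespace Sections

variable {𝓜 : SymplecticTwoManifold.{u, v} p X}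

/-- The right-hand side
`(-1)^{(k-1)u₁ + (k-2)u₂ + ⋯ + uₖ₋₁} (P[⋯[D χ_{u₁}, χ_{u₂}], …, χ_{uₖ}]
  - [P[⋯[D χ_{u₁}, χ_{u₂}], …, χ_{uₖ₋₁}], χ_{uₖ}])`
of the derived bracket formula, for `k = m + 1` and homogeneous sections of parities `q`. -/
noncomputable def derivedFormula (E : Sections.{u, v, w} 𝓜) (D : 𝓜.A →ₗ[ℝ] 𝓜.A) {m : ℕ}
    (q : Fin (m + 1) → ZMod 2) (u : Fin (m + 1) → E.V) : 𝓜.A :=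
  sgn (∑ i : Fin (m + 1), ((m - (i : ℕ) : ℕ) : ZMod 2) * q i) •
    derivedForm (𝓜.wt ⊤) 𝓜.bracket D m (fun i => (E.χ (u i) : 𝓜.A))

/-- The higher derived Dorfman brackets generated by `D`: the multilinear operations `dₖ` on
`Γ(E)` with `χ(dₖ(u₁, …, uₖ))` given by the derived bracket formula. The sign is implemented by
applying the parity involution `k - i` times to the `i`th argument, and the inverse of `χ` is
applied to the component of weight `1`, which is everything where the formula defines a section.
There is no operation without arguments; it is set to `0`. -/
noncomputable def dorfman (E : Sections.{u, v, w} 𝓜) (D : 𝓜.A →ₗ[ℝ] 𝓜.A) :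
    (k : ℕ) → MultilinearMap ℝ (fun _ : Fin k => E.V) E.V
  | 0 => 0
  | m + 1 => (E.χ.symm.toLinearMap ∘ₗ toWeightOne (𝓜.wt ⊤)).compMultilinearMap
      ((derivedForm (𝓜.wt ⊤) 𝓜.bracket D m).compLinearMap fun i =>
        (𝓜.Wt 1).subtype ∘ₗ E.χ.toLinearMap ∘ₗ parityInvolution E.par ^ (m - (i : ℕ)))

/-- `B` is the Dorfman bracket generated by the function `Θ` of weight `3`. -/
def IsDorfmanBracket (E : Sections.{u, v, w} 𝓜) (Θ : 𝓜.A) (B : E.V → E.V → E.V) : Prop :=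
  Θ ∈ 𝓜.Wt 3 ∧ ∀ (s : ZMod 2) (u v : E.V), u ∈ E.par s →
    (E.χ (B u v) : 𝓜.A) = sgn s • 𝓜.bracket (𝓜.bracket Θ (E.χ u)) (E.χ v)

end Sections

end Manifold

end HigherDorfman

/-!
For a list `S` of indices write `X_S = [⋯[θ, χ_{u_s}], ⋯]` for the iterated bracket with the
arguments indexed by `S`. Since `P[f, a] - [Pf, a]` is the component of weight `1` of `[f, a]` for
`a` of weight `1`, the derived bracket of these arguments is, up to a décalage sign, the component
of weight `1` of `X_S`. Hence `Jₙ` becomes the component of weight `1` of the sum over `k` and over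
the splittings `S ∪ T = {1, …, k - 1}` of the terms
`± [⋯[[X_S, (X_{T ∪ {k}})₁], χ_{uₖ₊₁}], ⋯, χ_{uₙ}]`.

By the Jacobi identity and the same formula for `P`, the sum over `k` telescopes to the sum of
`± [X_S, P X_T]` over the splittings of `{1, …, n}`. Without `P`, the Jacobi identity gives
`∑ ± [X_S, X_T] = [⋯[[θ, θ], χ_{u₁}], ⋯, χ_{uₙ}] = 2 [⋯[Q² χ_{u₁}, χ_{u₂}], ⋯, χ_{uₙ}]`.
In weight `1` the sum with `P` is half of the sum without it: `[P f, g]` and `[f, g - P g]` have the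
same component of weight `1`, and exchanging `S` and `T` turns `[P X_S, X_T]` into `[X_T, P X_S]`.
-/

namespace HigherDorfman

/-! ### Signs -/

@[simp] lemma sgn_zero : sgn 0 = 1 := by simp [sgn]

@[simp] lemma sgn_one : sgn 1 = -1 := by simp [sgn, ZMod.val_one]

lemma sgn_add (s t : ZMod 2) : sgn (s + t) = sgn s * sgn t := by
  have h : ∀ s : ZMod 2, s = 0 ∨ s = 1 := by decide
  rcases h s with rfl | rfl <;> rcases h t with rfl | rfl <;>
    simp [show (1 : ZMod 2) + 1 = 0 from rfl]

lemma sgn_natCast (n : ℕ) : sgn (n : ZMod 2) = (-1) ^ n := by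
  induction n with
  | zero => simp
  | succ n ih => rw [Nat.cast_succ, sgn_add, ih, sgn_one, pow_succ]

lemma sgn_sum {ι : Type*} (I : Finset ι) (f : ι → ZMod 2) :
    sgn (∑ i ∈ I, f i) = ∏ i ∈ I, sgn (f i) := by
  classical
  induction I using Finset.induction_on with
  | empty => simp
  | insert i I hi ih => rw [Finset.sum_insert hi, Finset.prod_insert hi, sgn_add, ih]

lemma sgn_smul_smul {M : Type*} [AddCommGroup M] [Module ℝ M] (s t : ZMod 2) (x : M) :
    sgn s • sgn t • x = sgn (s + t) • x := by
  rw [smul_smul, sgn_add]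

/-! ### Signed sums over splittings -/

section Splitting

variable {M N : Type*} [AddCommGroup M] [Module ℝ M] [AddCommGroup N] [Module ℝ N]

/-- The signed sum of `F S T` over all splittings of `0, …, c - 1` into two increasing lists `S`
and `T`. Each `m` in `S` contributes the sign `(-1) ^ ζ T' m`, where `T'` is the part of `T` below
`m`: this is the sign of moving `m` to the left past the elements of `T'`. -/
def splitSum (ζ : List ℕ → ℕ → ZMod 2) : ℕ → (List ℕ → List ℕ → M) → M
  | 0, F => F [] []
  | c + 1, F => splitSum ζ c (fun S T => F S (T ++ [c])) +
      splitSum ζ c (fun S T => sgn (ζ T c) • F (S ++ [c]) T)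

lemma splitSum_congr (ζ : List ℕ → ℕ → ZMod 2) (c : ℕ) {F G : List ℕ → List ℕ → M}
    (h : ∀ S T, (S ++ T).Perm (List.range c) → F S T = G S T) :
    splitSum ζ c F = splitSum ζ c G := by
  induction c generalizing F G with
  | zero => exact h [] [] (by simp)
  | succ c ih =>
    rw [List.range_succ] at h
    simp only [splitSum]
    congr 1 <;> refine ih fun S T hST => ?_
    · exact h _ _ (by simpa only [List.append_assoc] using hST.append_right [c])
    · rw [h]
      rw [List.append_assoc]
      exact (List.perm_append_comm.append_left S).trans
        (by simpa only [List.append_assoc] using hST.append_right [c])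

lemma splitSum_add (ζ : List ℕ → ℕ → ZMod 2) (c : ℕ) (F G : List ℕ → List ℕ → M) :
    splitSum ζ c (fun S T => F S T + G S T) = splitSum ζ c F + splitSum ζ c G := by
  induction c generalizing F G with
  | zero => rfl
  | succ c ih => simp only [splitSum, smul_add, ih, add_add_add_comm]

lemma map_splitSum (φ : M →ₗ[ℝ] N) (ζ : List ℕ → ℕ → ZMod 2) (c : ℕ)
    (F : List ℕ → List ℕ → M) :
    φ (splitSum ζ c F) = splitSum ζ c (fun S T => φ (F S T)) := by
  induction c generalizing F with
  | zero => rfl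
  | succ c ih => simp only [splitSum, map_add, ih, map_smul]

lemma smul_splitSum (r : ℝ) (ζ : List ℕ → ℕ → ZMod 2) (c : ℕ) (F : List ℕ → List ℕ → M) :
    r • splitSum ζ c F = splitSum ζ c (fun S T => r • F S T) :=
  map_splitSum (LinearMap.lsmul ℝ M r) ζ c F

/-- The exponent of the sign of exchanging an element of parity `p m` with the iterated bracket of
an odd element with elements of parities `p t`, for `t` in `T`. -/
def bracketExponent (p : ℕ → ZMod 2) (T : List ℕ) (m : ℕ) : ZMod 2 := (1 + (T.map p).sum) * p m

lemma splitSum_bracketExponent_swap (p : ℕ → ZMod 2) (c : ℕ) (F : List ℕ → List ℕ → M) :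
    splitSum (bracketExponent p) c F = splitSum (bracketExponent p) c (fun S T =>
      sgn ((1 + (S.map p).sum) * (1 + (T.map p).sum) + 1) • F T S) := by
  induction c generalizing F with
  | zero => simp [splitSum, show (1 : ZMod 2) + 1 = 0 from rfl]
  | succ c ih =>
    simp only [splitSum]
    rw [ih, add_comm, ih]
    congr 1 <;> congr 1 <;> ext S T <;>
      simp only [sgn_smul_smul, bracketExponent, List.map_append, List.sum_append,
        List.map_cons, List.map_nil, List.sum_cons, List.sum_nil] <;>
      congr 2 <;> generalize (S.map p).sum = s <;> generalize (T.map p).sum = t <;>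
      generalize p c = a <;> revert s t a <;> decide

/-- The exponent `(k - 1) q₁ + (k - 2) q₂ + ⋯ + qₖ₋₁` of the sign of applying `k` odd maps to
elements of parities `q₁, …, qₖ`: the `i`th element is passed by the last `k - i` maps. -/
def decalage : List (ZMod 2) → ZMod 2
  | [] => 0
  | x :: L => (L.length : ZMod 2) * x + decalage L

lemma decalage_append (L L' : List (ZMod 2)) :
    decalage (L ++ L') = decalage L + (L'.length : ZMod 2) * L.sum + decalage L' := by
  induction L with
  | nil => simp [decalage]
  | cons x L ih =>
    simp only [List.cons_append, decalage, ih, List.length_append, List.sum_cons, Nat.cast_add]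
    ring

lemma decalage_ofFn {m : ℕ} (q : Fin (m + 1) → ZMod 2) :
    decalage (List.ofFn q) = ∑ i : Fin (m + 1), ((m - (i : ℕ) : ℕ) : ZMod 2) * q i := by
  induction m with
  | zero => simp [decalage]
  | succ m ih =>
    rw [List.ofFn_succ, decalage, ih, Fin.sum_univ_succ (n := m + 1)]
    simp

/-- The exponent of the sign, including that of the permutation, of moving an element of parity
`q m` past elements of parities `q t`, for `t` in `T`. -/
def unshuffleExponent (q : ℕ → ZMod 2) (T : List ℕ) (m : ℕ) : ZMod 2 :=
  (T.length : ZMod 2) + (T.map q).sum * q m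

lemma sum_map_add_one {ι : Type*} (q : ι → ZMod 2) (L : List ι) :
    (L.map fun i => q i + 1).sum = (L.map q).sum + (L.length : ZMod 2) := by
  rw [List.sum_map_add, List.map_const', List.sum_replicate, nsmul_one]

-- The décalage signs convert the signs of elements of parity `q` into those of the elements of
-- opposite parity that represent them.
lemma splitSum_unshuffleExponent (q : ℕ → ZMod 2) (c : ℕ) (F : List ℕ → List ℕ → M) :
    splitSum (unshuffleExponent q) c (fun S T => sgn (decalage ((List.range c).map q) +
      decalage (S.map q) + decalage (T.map q) + ((T.length : ZMod 2) + 1) * (S.map q).sum +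
      (S.length : ZMod 2)) • F S T) = splitSum (bracketExponent fun m => q m + 1) c F := by
  induction c generalizing F with
  | zero => simp [splitSum, decalage]
  | succ c ih =>
    simp only [splitSum]
    rw [← ih, ← ih]
    congr 1 <;> refine splitSum_congr _ _ fun S T hST => ?_ <;>
    · have hsum : ((List.range c).map q).sum = (S.map q).sum + (T.map q).sum := by
        rw [← (hST.map q).sum_eq, List.map_append, List.sum_append]
      simp only [sgn_smul_smul, bracketExponent, unshuffleExponent, List.range_succ,
        List.map_append, List.sum_append, decalage_append, List.map_cons, List.map_nil,
        List.sum_cons, List.sum_nil, decalage, hsum, sum_map_add_one, List.length_append,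
        List.length_cons, List.length_nil, Nat.cast_add, Nat.cast_one, Nat.cast_zero]
      congr 2
      rw [← sub_eq_zero]
      ring_nf
      reduce_mod_char

-- The sign `decalage (S ++ [y] ++ R) + decalage (T ++ [x])` of a composition of two derived
-- brackets, `y` being the parity of the inner one, multiplied by the sign that it has in the
-- Loday identity: up to the sign of the splitting, only the constant `decalage (L ++ [x] ++ R)`
-- remains.
lemma decalage_composition {L S T : List (ZMod 2)} (hlen : L.length = S.length + T.length)
    (hsum : L.sum = S.sum + T.sum) (x : ZMod 2) (R : List (ZMod 2)) :
    ((R.length + 1 : ℕ) : ZMod 2) * T.length + ((T.length : ZMod 2) + 1) * S.sum +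
        decalage (S ++ [((T ++ [x]).length : ZMod 2) + (T ++ [x]).sum] ++ R) +
        decalage (T ++ [x]) =
      decalage L + decalage S + decalage T + ((T.length : ZMod 2) + 1) * S.sum + S.length +
        (((L ++ [x] ++ R).length : ZMod 2) + 1 + decalage (L ++ [x] ++ R)) := by
  simp only [decalage_append, decalage, List.sum_append, List.sum_cons, List.sum_nil,
    List.length_append, List.length_cons, List.length_nil, hlen, hsum, Nat.cast_add, Nat.cast_one,
    Nat.cast_zero]
  rw [← sub_eq_zero]
  ring_nf
  reduce_mod_char

end Splitting

/-! ### Weight components -/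

section Algebra

variable {A : Type*} [Ring A] [Algebra ℝ A]

section Weights

variable {wt : ℕ → Submodule ℝ A} [GradedAlgebra wt]

lemma proj_mem (k : ℕ) (f : A) : GradedAlgebra.proj wt k f ∈ wt k := by
  rw [GradedAlgebra.proj_apply]
  exact SetLike.coe_mem _

lemma proj_of_mem {k : ℕ} {f : A} (hf : f ∈ wt k) (l : ℕ) :
    GradedAlgebra.proj wt l f = if k = l then f else 0 := by
  rw [GradedAlgebra.proj_apply]
  split_ifs with h
  · rw [← h, DirectSum.decompose_of_mem_same wt hf]
  · rw [DirectSum.decompose_of_mem_ne wt hf h]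

lemma proj_proj (k l : ℕ) (f : A) : GradedAlgebra.proj wt l (GradedAlgebra.proj wt k f) =
    if k = l then GradedAlgebra.proj wt k f else 0 :=
  proj_of_mem (proj_mem k f) l

lemma proj_projP (k : ℕ) (f : A) :
    GradedAlgebra.proj wt k (projP wt f) = if k < 2 then GradedAlgebra.proj wt k f else 0 := by
  rw [projP, LinearMap.add_apply, map_add, proj_proj, proj_proj]
  rcases k with _ | _ | k <;> simp

lemma coe_toWeightOne (f : A) : (toWeightOne wt f : A) = GradedAlgebra.proj wt 1 f := by
  rw [GradedAlgebra.proj_apply]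
  rfl

lemma projP_mem_par {par : ZMod 2 → Submodule ℝ A}
    (hproj : ∀ k s f, f ∈ par s → GradedAlgebra.proj wt k f ∈ par s) {s : ZMod 2} {f : A}
    (hf : f ∈ par s) : projP wt f ∈ par s :=
  add_mem (hproj 0 s f hf) (hproj 1 s f hf)

end Weights

namespace IsWeightTwoPoisson

variable {wt : ℕ → Submodule ℝ A} [GradedAlgebra wt] {par : ZMod 2 → Submodule ℝ A}
  {br : A →ₗ[ℝ] A →ₗ[ℝ] A} (h : IsWeightTwoPoisson wt par br)
include h

lemma proj_br (k : ℕ) (f g : A) : GradedAlgebra.proj wt k (br f g) =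
    ∑ ij ∈ Finset.HasAntidiagonal.antidiagonal (k + 2),
      br (GradedAlgebra.proj wt ij.1 f) (GradedAlgebra.proj wt ij.2 g) := by
  induction f using DirectSum.Decomposition.inductionOn wt with
  | zero => simp
  | add f f' hf hf' => simp only [map_add, LinearMap.add_apply, hf, hf', Finset.sum_add_distrib]
  | @homogeneous i f =>
    induction g using DirectSum.Decomposition.inductionOn wt with
    | zero => simp
    | add g g' hg hg' => simp only [map_add, hg, hg', Finset.sum_add_distrib]
    | @homogeneous j g =>
      obtain ⟨f, hf⟩ := f
      obtain ⟨g, hg⟩ := g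
      simp only [proj_of_mem hf, proj_of_mem hg]
      by_cases hij : i + j = k + 2
      · rw [proj_of_mem (h.wt_mem i j k f g hf hg hij.symm), if_pos rfl,
          Finset.sum_eq_single_of_mem (i, j) (Finset.HasAntidiagonal.mem_antidiagonal.2 hij)]
        · simp
        · rintro ⟨i', j'⟩ _ hne
          split_ifs <;> simp_all
      · have hzero : GradedAlgebra.proj wt k (br f g) = 0 := by
          by_cases hlt : i + j < 2
          · rw [h.wt_neg i j f g hf hg hlt, map_zero]
          · rw [proj_of_mem (h.wt_mem i j (i + j - 2) f g hf hg (by omega)),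
              if_neg (by omega)]
        rw [hzero, Finset.sum_eq_zero]
        rintro ⟨i', j'⟩ hij'
        rw [Finset.HasAntidiagonal.mem_antidiagonal] at hij'
        split_ifs <;> simp_all

lemma proj_br_of_mem_one {a : A} (ha : a ∈ wt 1) (k : ℕ) (f : A) :
    GradedAlgebra.proj wt k (br f a) = br (GradedAlgebra.proj wt (k + 1) f) a := by
  rw [h.proj_br, Finset.sum_eq_single_of_mem (k + 1, 1) (by simp [add_assoc])]
  · rw [proj_of_mem ha, if_pos rfl]
  · rintro ⟨i, j⟩ hij hne
    rw [Finset.HasAntidiagonal.mem_antidiagonal] at hij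
    rw [proj_of_mem ha, if_neg fun hj => hne (Prod.ext (by simp only; omega) hj.symm), map_zero]

lemma proj_br_eq_zero {f g : A} {k l m : ℕ} (hf : ∀ i < k, GradedAlgebra.proj wt i f = 0)
    (hg : ∀ j < l, GradedAlgebra.proj wt j g = 0) (hm : m + 2 < k + l) :
    GradedAlgebra.proj wt m (br f g) = 0 := by
  rw [h.proj_br]
  refine Finset.sum_eq_zero fun ij hij => ?_
  rw [Finset.HasAntidiagonal.mem_antidiagonal] at hij
  rcases lt_or_ge ij.1 k with hi | hi
  · rw [hf _ hi, map_zero, LinearMap.zero_apply]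
  · rw [hg _ (by omega), map_zero]

lemma proj_zero_br_of_mem_one {f b : A} (hf : GradedAlgebra.proj wt 1 f = 0) (hb : b ∈ wt 1) :
    GradedAlgebra.proj wt 0 (br f b) = 0 := by
  rw [h.proj_br_of_mem_one hb, zero_add, hf, map_zero, LinearMap.zero_apply]

lemma proj_zero_br_br_of_mem_one {f b : A} (hf : projP wt f = 0) (hb : b ∈ wt 1) :
    GradedAlgebra.proj wt 0 (br f (br f b)) = 0 := by
  have hlow : ∀ i < 2, GradedAlgebra.proj wt i f = 0 := fun i hi => by
    simpa [hf, hi] using (proj_projP (wt := wt) i f).symm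
  refine h.proj_br_eq_zero hlow (l := 1) (fun i hi => ?_) (by omega)
  rw [Nat.lt_one_iff.1 hi, h.proj_zero_br_of_mem_one (hlow 1 one_lt_two) hb]

lemma projP_br_sub {a : A} (ha : a ∈ wt 1) (f : A) :
    projP wt (br f a) - br (projP wt f) a = GradedAlgebra.proj wt 1 (br f a) := by
  simp only [projP, LinearMap.add_apply, map_add, h.proj_br_of_mem_one ha,
    h.wt_neg 0 1 _ a (proj_mem 0 f) ha (by omega)]
  abel

lemma proj_one_br_projP {a : A} (ha : a ∈ wt 1) (f : A) :
    GradedAlgebra.proj wt 1 (br (projP wt f) a) = 0 := by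
  rw [h.proj_br_of_mem_one ha, proj_projP, if_neg (by omega), map_zero, LinearMap.zero_apply]

-- The weights of the two arguments add up to `3`, so exactly one of them is at most `1`.
lemma proj_one_br_projP_left (f g : A) : GradedAlgebra.proj wt 1 (br (projP wt f) g) =
    GradedAlgebra.proj wt 1 (br f (g - projP wt g)) := by
  rw [h.proj_br, h.proj_br]
  refine Finset.sum_congr rfl fun ij hij => ?_
  rw [Finset.HasAntidiagonal.mem_antidiagonal] at hij
  rw [map_sub, proj_projP, proj_projP]
  rcases lt_or_ge ij.1 2 with hi | hi
  · rw [if_pos hi, if_neg (by omega), sub_zero]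
  · rw [if_neg hi.not_gt, if_pos (by omega), sub_self, map_zero, map_zero, LinearMap.zero_apply]

end IsWeightTwoPoisson

/-! ### Iterated brackets -/

/-- The iterated bracket `f ↦ [⋯[f, a i₁], …, a iₖ]` for a list of indices `i₁, …, iₖ`. -/
def iteratedBr {ι : Type*} (br : A →ₗ[ℝ] A →ₗ[ℝ] A) (a : ι → A) : List ι → A →ₗ[ℝ] A
  | [] => LinearMap.id
  | i :: L => iteratedBr br a L ∘ₗ br.flip (a i)

variable {ι : Type*} {br : A →ₗ[ℝ] A →ₗ[ℝ] A}

@[simp] lemma iteratedBr_nil (a : ι → A) (f : A) : iteratedBr br a [] f = f := rfl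

@[simp] lemma iteratedBr_cons (a : ι → A) (i : ι) (L : List ι) (f : A) :
    iteratedBr br a (i :: L) f = iteratedBr br a L (br f (a i)) := rfl

lemma iteratedBr_map {κ : Type*} (a : κ → A) (g : ι → κ) (L : List ι) (f : A) :
    iteratedBr br a (L.map g) f = iteratedBr br (fun i => a (g i)) L f := by
  induction L generalizing f with
  | nil => rfl
  | cons i _ ih => exact ih (br f (a (g i)))

lemma iteratedBr_append (a : ι → A) (L L' : List ι) (f : A) :
    iteratedBr br a (L ++ L') f = iteratedBr br a L' (iteratedBr br a L f) := by
  induction L generalizing f with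
  | nil => rfl
  | cons i _ ih => exact ih (br f (a i))

lemma iteratedBr_concat (a : ι → A) (L : List ι) (i : ι) (f : A) :
    iteratedBr br a (L ++ [i]) f = br (iteratedBr br a L f) (a i) :=
  iteratedBr_append a L [i] f

lemma nested_eq_iteratedBr (D : A →ₗ[ℝ] A) (k : ℕ) (a : ι → A) (f : Fin (k + 1) → ι) :
    nested br D k (fun j => a (f j)) =
      iteratedBr br a (List.ofFn (Fin.tail f)) (D (a (f 0))) := by
  induction k with
  | zero => simp [nested]
  | succ k ih =>
    rw [List.ofFn_succ', List.concat_eq_append, iteratedBr_concat]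
    exact congrArg (fun x => br x (a (f (Fin.last (k + 1))))) (ih (Fin.init f))

section Poisson

variable {wt : ℕ → Submodule ℝ A} {par : ZMod 2 → Submodule ℝ A}
  (h : IsWeightTwoPoisson wt par br)
include h

lemma iteratedBr_mem_par {a : ι → A} {p : ι → ZMod 2} {L : List ι}
    (ha : ∀ i ∈ L, a i ∈ par (p i)) {s : ZMod 2} {f : A} (hf : f ∈ par s) :
    iteratedBr br a L f ∈ par (s + (L.map p).sum) := by
  induction L generalizing s f with
  | nil => simpa using hf
  | cons i L ih =>
    rw [iteratedBr_cons, List.map_cons, List.sum_cons, ← add_assoc]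
    exact ih (fun j hj => ha j (List.mem_cons_of_mem i hj))
      (h.par_mem _ _ _ _ hf (ha i List.mem_cons_self))

variable [GradedAlgebra wt]

lemma proj_one_derivedForm (D : A →ₗ[ℝ] A) (k : ℕ) {a : Fin (k + 1) → A} (ha : ∀ i, a i ∈ wt 1) :
    GradedAlgebra.proj wt 1 (derivedForm wt br D k a) =
      GradedAlgebra.proj wt 1 (nested br D k a) := by
  cases k with
  | zero =>
    simp only [derivedForm, LinearMap.compMultilinearMap_apply, proj_projP, if_pos one_lt_two]
  | succ k =>
    simp only [derivedForm, sub_apply, MultilinearMap.uncurryRight_apply,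
      LinearMap.compMultilinearMap_apply, LinearMap.comp_apply, map_sub, proj_projP,
      if_pos one_lt_two, h.proj_one_br_projP (ha _), sub_zero]

lemma derivedForm_eq_proj_one {D : A →ₗ[ℝ] A}
    (hD : ∀ b ∈ wt 1, GradedAlgebra.proj wt 0 (D b) = 0) (k : ℕ) {a : Fin (k + 1) → A}
    (ha : ∀ i, a i ∈ wt 1) :
    derivedForm wt br D k a = GradedAlgebra.proj wt 1 (nested br D k a) := by
  cases k with
  | zero => simp [derivedForm, nested, projP, hD _ (ha _)]
  | succ k => simp [derivedForm, nested, h.projP_br_sub (ha _)]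

end Poisson

end Algebra

/-! ### The quadratic identity -/

section Quadratic

variable {A : Type*} [Ring A] [Algebra ℝ A] {wt : ℕ → Submodule ℝ A} {par : ZMod 2 → Submodule ℝ A}
  {br : A →ₗ[ℝ] A →ₗ[ℝ] A} (h : IsWeightTwoPoisson wt par br)
include h

lemma br_br_right {r s t : ZMod 2} {f g b : A} (hf : f ∈ par r) (hg : g ∈ par s)
    (hb : b ∈ par t) : br (br f g) b = br f (br g b) + sgn (s * t) • br (br f b) g := by
  rw [h.jacobi r s f g b hf hg, h.super_skew s (r + t) g (br f b) hg (h.par_mem _ _ _ _ hf hb),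
    smul_neg, sgn_smul_smul, show r * s + s * (r + t) = s * t by
      rw [← sub_eq_zero]; ring_nf; reduce_mod_char]
  abel

variable {θ : A} (hθ : θ ∈ par 1)
include hθ

lemma br_br_self (b : A) : br (br θ θ) b = (2 : ℝ) • br θ (br θ b) := by
  have hjacobi := h.jacobi 1 1 θ θ b hθ hθ
  rw [mul_one, sgn_one, neg_one_smul] at hjacobi
  rw [two_smul]
  nth_rewrite 1 [hjacobi]
  rw [neg_add_cancel_right]

variable {a : ℕ → A} {p : ℕ → ZMod 2} (ha : ∀ i, a i ∈ par (p i))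
include ha

lemma br_splitSum (Φ : A →ₗ[ℝ] A) (hΦ : ∀ s f, f ∈ par s → Φ f ∈ par s) (c : ℕ) :
    br (splitSum (bracketExponent p) c fun S T =>
      br (iteratedBr br a S θ) (Φ (iteratedBr br a T θ))) (a c) =
    splitSum (bracketExponent p) c (fun S T =>
      br (iteratedBr br a S θ) (br (Φ (iteratedBr br a T θ)) (a c))) +
    splitSum (bracketExponent p) c (fun S T => sgn (bracketExponent p T c) •
      br (iteratedBr br a (S ++ [c]) θ) (Φ (iteratedBr br a T θ))) := by
  have hpar : ∀ L : List ℕ, iteratedBr br a L θ ∈ par (1 + (L.map p).sum) := fun L =>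
    iteratedBr_mem_par h (fun i _ => ha i) hθ
  rw [← LinearMap.flip_apply, map_splitSum, ← splitSum_add]
  refine splitSum_congr _ _ fun S T _ => ?_
  rw [LinearMap.flip_apply, br_br_right h (hpar S) (hΦ _ _ (hpar T)) (ha c), iteratedBr_concat]
  rfl

lemma splitSum_br_iteratedBr (c : ℕ) :
    splitSum (bracketExponent p) c (fun S T =>
      br (iteratedBr br a S θ) (iteratedBr br a T θ)) =
    iteratedBr br a (List.range c) (br θ θ) := by
  induction c with
  | zero => rfl
  | succ c ih =>
    rw [List.range_succ, iteratedBr_concat, ← ih]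
    refine Eq.trans ?_ (br_splitSum h hθ ha LinearMap.id (fun _ _ hf => hf) c).symm
    simp only [splitSum, iteratedBr_concat, LinearMap.id_apply]

variable [GradedAlgebra wt] (hproj : ∀ k s f, f ∈ par s → GradedAlgebra.proj wt k f ∈ par s)
include hproj

-- By `proj_one_br_projP_left` and skew-symmetry, replacing `P X_T` by `X_T` in the sum of the
-- brackets `[X_S, P X_T]` doubles its component of weight `1`.
lemma proj_one_splitSum_br_projP (n : ℕ) :
    (2 : ℝ) • GradedAlgebra.proj wt 1 (splitSum (bracketExponent p) n fun S T =>
      br (iteratedBr br a S θ) (projP wt (iteratedBr br a T θ))) =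
    GradedAlgebra.proj wt 1 (splitSum (bracketExponent p) n fun S T =>
      br (iteratedBr br a S θ) (iteratedBr br a T θ)) := by
  have hpar : ∀ L : List ℕ, iteratedBr br a L θ ∈ par (1 + (L.map p).sum) := fun L =>
    iteratedBr_mem_par h (fun i _ => ha i) hθ
  rw [two_smul]
  nth_rewrite 2 [splitSum_bracketExponent_swap]
  rw [← map_add, ← splitSum_add, map_splitSum, map_splitSum]
  refine splitSum_congr _ _ fun S T _ => ?_
  have hswap : sgn ((1 + (S.map p).sum) * (1 + (T.map p).sum) + 1) •
      br (iteratedBr br a T θ) (projP wt (iteratedBr br a S θ)) =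
        br (projP wt (iteratedBr br a S θ)) (iteratedBr br a T θ) := by
    rw [h.super_skew _ _ _ _ (projP_mem_par hproj (hpar S)) (hpar T), sgn_add, sgn_one,
      mul_neg_one, neg_smul]
  rw [hswap, map_add, h.proj_one_br_projP_left, ← map_add, ← map_add, add_sub_cancel]

variable (ha_wt : ∀ i, a i ∈ wt 1) (hP : projP wt θ = 0)
include ha_wt hP

lemma sum_iteratedBr_splitSum (n : ℕ) :
    ∑ c ∈ Finset.range n, iteratedBr br a ((List.range n).drop (c + 1))
      (splitSum (bracketExponent p) c fun S T =>
        br (iteratedBr br a S θ) (GradedAlgebra.proj wt 1 (iteratedBr br a (T ++ [c]) θ))) =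
    splitSum (bracketExponent p) n (fun S T =>
      br (iteratedBr br a S θ) (projP wt (iteratedBr br a T θ))) := by
  induction n with
  | zero => simp [splitSum, hP]
  | succ n ih =>
    have hdrop : ∀ c ∈ Finset.range n, ∀ x : A,
        iteratedBr br a ((List.range (n + 1)).drop (c + 1)) x =
          br.flip (a n) (iteratedBr br a ((List.range n).drop (c + 1)) x) := by
      intro c hc x
      rw [List.range_succ, List.drop_append_of_le_length (by simpa using hc),
        iteratedBr_concat, LinearMap.flip_apply]
    rw [Finset.sum_range_succ, List.drop_of_length_le (by simp), iteratedBr_nil,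
      Finset.sum_congr rfl fun c hc => hdrop c hc _, ← map_sum, ih, LinearMap.flip_apply,
      br_splitSum h hθ ha (projP wt) (fun _ _ => projP_mem_par hproj) n, splitSum,
      add_right_comm, ← splitSum_add]
    congr 1
    refine splitSum_congr _ _ fun S T _ => ?_
    rw [← map_add, iteratedBr_concat, ← h.projP_br_sub (ha_wt n), add_sub_cancel]

lemma proj_one_sum_iteratedBr_splitSum (n : ℕ) :
    GradedAlgebra.proj wt 1
      (∑ c ∈ Finset.range (n + 1), iteratedBr br a ((List.range (n + 1)).drop (c + 1))
        (splitSum (bracketExponent p) c fun S T =>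
          br (iteratedBr br a S θ) (GradedAlgebra.proj wt 1 (iteratedBr br a (T ++ [c]) θ)))) =
    GradedAlgebra.proj wt 1
      (iteratedBr br a ((List.range (n + 1)).drop 1) (br θ (br θ (a 0)))) := by
  refine smul_right_injective A (two_ne_zero' ℝ) ?_
  beta_reduce
  rw [sum_iteratedBr_splitSum h hθ ha hproj ha_wt hP, proj_one_splitSum_br_projP h hθ ha hproj,
    splitSum_br_iteratedBr h hθ ha, List.range_eq_range', List.range'_succ, iteratedBr_cons,
    br_br_self h hθ, map_smul, map_smul, List.drop_one, List.tail_cons]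

end Quadratic

/-! ### Unshuffles -/

section Unshuffle

variable {M : Type*} [AddCommGroup M] [Module ℝ M]

/-- The exponent of the sign, including that of the permutation, of reordering the elements of
parities `q x`, for `x` in `S ∪ T`, so that those with index in `S` come first. -/
def inversionExponent (q : ℕ → ZMod 2) (S T : Finset ℕ) : ZMod 2 :=
  ∑ s ∈ S, ∑ t ∈ T, if t < s then 1 + q s * q t else 0

lemma inversionExponent_insert_right (q : ℕ → ZMod 2) {c : ℕ} {S T : Finset ℕ}
    (hS : S ⊆ Finset.range c) (hc : c ∉ T) :
    inversionExponent q S (insert c T) = inversionExponent q S T := by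
  refine Finset.sum_congr rfl fun s hs => ?_
  rw [Finset.sum_insert hc, if_neg (Finset.mem_range.1 (hS hs)).not_gt, zero_add]

lemma inversionExponent_insert_left (q : ℕ → ZMod 2) {c : ℕ} {S T : Finset ℕ} (hc : c ∉ S)
    (hT : T ⊆ Finset.range c) :
    inversionExponent q (insert c S) T =
      inversionExponent q S T + unshuffleExponent q (T.sort (· ≤ ·)) c := by
  have hsum : ((T.sort (· ≤ ·)).map q).sum = ∑ t ∈ T, q t := by
    rw [← List.sum_toFinset _ (Finset.sort_nodup _ _), Finset.sort_toFinset]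
  rw [inversionExponent, Finset.sum_insert hc, add_comm, unshuffleExponent, Finset.length_sort,
    hsum, Finset.sum_congr rfl fun t ht => if_pos (Finset.mem_range.1 (hT ht)),
    Finset.sum_add_distrib, Finset.sum_const, nsmul_one, ← Finset.mul_sum, mul_comm (q c)]
  rfl

lemma sort_insert_of_subset_range {c : ℕ} {S : Finset ℕ} (hS : S ⊆ Finset.range c) :
    (insert c S).sort (· ≤ ·) = S.sort (· ≤ ·) ++ [c] := by
  have hlt : ∀ x ∈ S.sort (· ≤ ·), ∀ y ∈ [c], x < y := fun x hx y hy => by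
    rw [List.mem_singleton.1 hy]
    exact Finset.mem_range.1 (hS ((Finset.mem_sort _).1 hx))
  have hsorted : (S.sort (· ≤ ·) ++ [c]).Pairwise (· < ·) :=
    List.pairwise_append.2
      ⟨(Finset.sortedLT_sort S).pairwise, List.pairwise_singleton _ c, hlt⟩
  rw [← (List.toFinset_sort (· ≤ ·) (hsorted.imp ne_of_lt)).2 (hsorted.imp le_of_lt),
    List.toFinset_append, Finset.sort_toFinset, Finset.union_comm]
  rfl

lemma sum_powerset_range (q : ℕ → ZMod 2) (c : ℕ) (F : List ℕ → List ℕ → M) :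
    ∑ S ∈ (Finset.range c).powerset, sgn (inversionExponent q S (Finset.range c \ S)) •
      F (S.sort (· ≤ ·)) ((Finset.range c \ S).sort (· ≤ ·)) =
    splitSum (unshuffleExponent q) c F := by
  induction c generalizing F with
  | zero => simp [splitSum, inversionExponent]
  | succ c ih =>
    rw [Finset.range_add_one, Finset.sum_powerset_insert Finset.notMem_range_self, splitSum, ← ih,
      ← ih]
    congr 1 <;> refine Finset.sum_congr rfl fun S hS => ?_ <;>
      rw [Finset.mem_powerset] at hS <;>
      have hc : c ∉ S := fun hc => Finset.notMem_range_self (hS hc)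
    · rw [Finset.insert_sdiff_of_notMem _ hc, sort_insert_of_subset_range Finset.sdiff_subset,
        inversionExponent_insert_right q hS (by simp)]
    · rw [Finset.insert_sdiff_insert, Finset.sdiff_insert_of_notMem Finset.notMem_range_self,
        sort_insert_of_subset_range hS, sgn_smul_smul,
        inversionExponent_insert_left q hc Finset.sdiff_subset]

variable {c : ℕ}

/-- The one-line notation of a permutation of `0, …, c - 1`: the list of its values. -/
def oneLine (σ : Equiv.Perm (Fin c)) : List ℕ := List.ofFn fun x => (σ x : ℕ)

lemma injective_val_perm (σ : Equiv.Perm (Fin c)) : Function.Injective fun x => (σ x : ℕ) :=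
  Fin.val_injective.comp σ.injective

@[simp] lemma length_oneLine (σ : Equiv.Perm (Fin c)) : (oneLine σ).length = c :=
  List.length_ofFn

lemma oneLine_injective : Function.Injective (oneLine (c := c)) := fun _ _ h =>
  Equiv.ext fun x => Fin.ext (congrFun (List.ofFn_injective h) x)

lemma oneLine_perm_range (σ : Equiv.Perm (Fin c)) : (oneLine σ).Perm (List.range c) := by
  rw [← List.map_coe_finRange_eq_range, ← List.ofFn_eq_map]
  exact Equiv.Perm.ofFn_comp_perm σ _

lemma exists_oneLine_eq {K : List ℕ} (hK : K.Perm (List.range c)) :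
    ∃ σ : Equiv.Perm (Fin c), oneLine σ = K := by
  have hlen : K.length = c := by simpa using hK.length_eq
  have hlt : ∀ x ∈ K, x < c := fun x hx => List.mem_range.1 (hK.subset hx)
  let f : Fin c → Fin c := fun x => ⟨K[(x : ℕ)], hlt _ (List.getElem_mem _)⟩
  have hf : Function.Injective f := fun x y hxy =>
    Fin.ext ((hK.nodup_iff.2 List.nodup_range).getElem_inj_iff.1 (Fin.ext_iff.1 hxy))
  refine ⟨Equiv.ofBijective f (Finite.injective_iff_bijective.1 hf), ?_⟩
  exact List.ext_getElem (by simp [hlen]) fun i _ _ => by simp [oneLine, f]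

lemma mem_unshuffles_iff {a : ℕ} {σ : Equiv.Perm (Fin c)} : σ ∈ unshuffles a c ↔
    ((oneLine σ).take a).Pairwise (· < ·) ∧ ((oneLine σ).drop a).Pairwise (· < ·) := by
  simp only [unshuffles, Finset.mem_filter_univ, List.pairwise_iff_getElem, List.length_take,
    List.length_drop, List.getElem_take, List.getElem_drop, oneLine, List.getElem_ofFn,
    List.length_ofFn]
  refine ⟨fun hσ => ⟨fun i j _ _ hij => ?_, fun i j _ _ hij => ?_⟩, ?_⟩
  · exact hσ _ _ hij (Or.inl (by simp only; omega))
  · exact hσ _ _ (by simpa using hij) (Or.inr (by simp only; omega))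
  · rintro ⟨htake, hdrop⟩ x y hxy (hy | hx)
    · exact htake x y (by omega) (by omega) hxy
    · have hxy' := hdrop (x - a) (y - a) (by omega) (by omega) (by omega)
      simpa only [Nat.add_sub_cancel' hx, Nat.add_sub_cancel' (hx.trans hxy.le), Fin.eta,
        Fin.val_fin_lt] using hxy'

/-- The values of `σ` at the positions below `a`. An unshuffle is determined by this set. -/
def headSet (a : ℕ) (σ : Equiv.Perm (Fin c)) : Finset ℕ :=
  ({x : Fin c | (x : ℕ) < a} : Finset (Fin c)).image fun x => (σ x : ℕ)

lemma toFinset_take_oneLine (a : ℕ) (σ : Equiv.Perm (Fin c)) :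
    ((oneLine σ).take a).toFinset = headSet a σ := by
  ext y
  simp only [headSet, oneLine, List.mem_toFinset, List.mem_take_iff_getElem, List.getElem_ofFn,
    Finset.mem_image, Finset.mem_filter_univ, List.length_ofFn]
  constructor
  · rintro ⟨i, hi, rfl⟩
    exact ⟨⟨i, by omega⟩, by simp only; omega, rfl⟩
  · rintro ⟨x, hx, rfl⟩
    exact ⟨x, by omega, rfl⟩

lemma toFinset_drop_oneLine (a : ℕ) (σ : Equiv.Perm (Fin c)) :
    ((oneLine σ).drop a).toFinset = Finset.range c \ headSet a σ := by
  have hdisj : Disjoint ((oneLine σ).take a).toFinset ((oneLine σ).drop a).toFinset :=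
    List.disjoint_toFinset_iff_disjoint.2
      (List.disjoint_take_drop ((oneLine_perm_range σ).nodup_iff.2 List.nodup_range) le_rfl)
  rw [← List.toFinset_range, ← List.toFinset_eq_of_perm _ _ (oneLine_perm_range σ),
    ← toFinset_take_oneLine]
  nth_rewrite 2 [← List.take_append_drop a (oneLine σ)]
  rw [List.toFinset_append, Finset.union_sdiff_cancel_left hdisj]

lemma range_sdiff_headSet (a : ℕ) (σ : Equiv.Perm (Fin c)) : Finset.range c \ headSet a σ =
    ({x : Fin c | a ≤ (x : ℕ)} : Finset (Fin c)).image fun x => (σ x : ℕ) := by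
  have huniv : Finset.range c = Finset.univ.image fun x => (σ x : ℕ) := by
    rw [← List.toFinset_range, ← List.toFinset_eq_of_perm _ _ (oneLine_perm_range σ)]
    ext
    simp [oneLine]
  rw [huniv, headSet, ← Finset.image_sdiff _ _ (injective_val_perm σ)]
  congr 1
  ext x
  simp

lemma headSet_mem_powersetCard {a : ℕ} (ha : a ≤ c) (σ : Equiv.Perm (Fin c)) :
    headSet a σ ∈ (Finset.range c).powersetCard a := by
  rw [Finset.mem_powersetCard]
  constructor
  · rw [headSet, Finset.image_subset_iff]
    exact fun x _ => Finset.mem_range.2 (σ x).isLt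
  · rw [headSet, Finset.card_image_of_injective _ (injective_val_perm σ), Fin.card_filter_val_lt,
      min_eq_right ha]

lemma sort_headSet {a : ℕ} {σ : Equiv.Perm (Fin c)} (hσ : σ ∈ unshuffles a c) :
    (headSet a σ).sort (· ≤ ·) = (oneLine σ).take a := by
  have hsorted := (mem_unshuffles_iff.1 hσ).1
  rw [← toFinset_take_oneLine]
  exact (List.toFinset_sort _ (hsorted.imp ne_of_lt)).2 (hsorted.imp le_of_lt)

lemma sort_range_sdiff_headSet {a : ℕ} {σ : Equiv.Perm (Fin c)} (hσ : σ ∈ unshuffles a c) :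
    (Finset.range c \ headSet a σ).sort (· ≤ ·) = (oneLine σ).drop a := by
  have hsorted := (mem_unshuffles_iff.1 hσ).2
  rw [← toFinset_drop_oneLine]
  exact (List.toFinset_sort _ (hsorted.imp ne_of_lt)).2 (hsorted.imp le_of_lt)

lemma injOn_headSet (a : ℕ) : Set.InjOn (headSet a) (unshuffles a c : Set (Equiv.Perm (Fin c))) :=
  fun σ hσ τ hτ hστ => oneLine_injective <| by
    rw [← List.take_append_drop a (oneLine σ), ← sort_headSet hσ, ← sort_range_sdiff_headSet hσ,
      hστ, sort_headSet hτ, sort_range_sdiff_headSet hτ, List.take_append_drop]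

lemma exists_unshuffle {S : Finset ℕ} (hS : S ⊆ Finset.range c) :
    ∃ σ ∈ unshuffles S.card c, headSet S.card σ = S := by
  have hperm : (S.sort (· ≤ ·) ++ (Finset.range c \ S).sort (· ≤ ·)).Perm (List.range c) := by
    refine List.perm_of_nodup_nodup_toFinset_eq ?_ List.nodup_range ?_
    · rw [List.nodup_append']
      refine ⟨Finset.sort_nodup _ _, Finset.sort_nodup _ _, ?_⟩
      rw [← List.disjoint_toFinset_iff_disjoint, Finset.sort_toFinset, Finset.sort_toFinset]
      exact Finset.disjoint_sdiff
    · rw [List.toFinset_append, Finset.sort_toFinset, Finset.sort_toFinset, List.toFinset_range,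
        Finset.union_sdiff_of_subset hS]
  obtain ⟨σ, hσ⟩ := exists_oneLine_eq hperm
  refine ⟨σ, mem_unshuffles_iff.2 ?_, ?_⟩
  · rw [hσ, List.take_left' (Finset.length_sort _), List.drop_left' (Finset.length_sort _)]
    exact ⟨(Finset.sortedLT_sort S).pairwise, (Finset.sortedLT_sort _).pairwise⟩
  · rw [← toFinset_take_oneLine, hσ, List.take_left' (Finset.length_sort _), Finset.sort_toFinset]

lemma sign_eq_prod_inversions (σ : Equiv.Perm (Fin c)) :
    ((Equiv.Perm.sign σ : ℤ) : ℝ) =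
      ∏ x : Fin c, ∏ y : Fin c, if x < y ∧ σ y < σ x then -1 else 1 := by
  rw [Equiv.Perm.sign_eq_prod_prod_Ioi]
  push_cast
  refine Finset.prod_congr rfl fun x _ => ?_
  simp only [ite_and]
  rw [← Finset.prod_filter, Finset.filter_lt_eq_Ioi]
  refine Finset.prod_congr rfl fun y hy => ?_
  have hne : σ x ≠ σ y := σ.injective.ne (Finset.mem_Ioi.1 hy).ne
  rcases hne.lt_or_gt with hlt | hlt <;> simp [hlt, hlt.not_gt]

lemma sign_mul_koszulSign_eq_sgn_sum (q : Fin c → ZMod 2) (σ : Equiv.Perm (Fin c)) :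
    ((Equiv.Perm.sign σ : ℤ) : ℝ) * koszulSign q σ =
      sgn (∑ x, ∑ y, if x < y ∧ σ y < σ x then 1 + q (σ x) * q (σ y) else 0) := by
  simp only [sign_eq_prod_inversions, koszulSign, sgn_sum, ← Finset.prod_mul_distrib]
  refine Finset.prod_congr rfl fun x _ => Finset.prod_congr rfl fun y _ => ?_
  split_ifs <;> simp [sgn_add]

lemma sign_mul_koszulSign (q : ℕ → ZMod 2) {a : ℕ} {σ : Equiv.Perm (Fin c)}
    (hσ : σ ∈ unshuffles a c) :
    ((Equiv.Perm.sign σ : ℤ) : ℝ) * koszulSign (fun x : Fin c => q x) σ =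
      sgn (inversionExponent q (headSet a σ) (Finset.range c \ headSet a σ)) := by
  have hinversion : ∀ x y : Fin c,
      (x < y ∧ σ y < σ x) ↔ ((x : ℕ) < a ∧ a ≤ (y : ℕ) ∧ σ y < σ x) := fun x y => by
    have hσxy := (Finset.mem_filter_univ _).1 hσ x y
    grind
  rw [sign_mul_koszulSign_eq_sgn_sum, range_sdiff_headSet, headSet, inversionExponent]
  simp only [hinversion, Finset.sum_image (injective_val_perm σ).injOn, Finset.sum_filter, ite_and]
  congr 1
  refine Finset.sum_congr rfl fun x _ => ?_
  split_ifs <;> simp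

lemma sum_unshuffles (q : ℕ → ZMod 2) (c : ℕ) (F : List ℕ → List ℕ → M) :
    ∑ b ∈ Finset.range (c + 1), ∑ σ ∈ unshuffles (c - b) c,
      (((Equiv.Perm.sign σ : ℤ) : ℝ) * koszulSign (fun x : Fin c => q x) σ) •
        F ((oneLine σ).take (c - b)) ((oneLine σ).drop (c - b)) =
    splitSum (unshuffleExponent q) c F := by
  rw [← sum_powerset_range, Finset.sum_powerset, Finset.card_range]
  refine Eq.trans (Finset.sum_congr rfl fun b _ => ?_) (Finset.sum_range_reflect _ (c + 1))
  rw [Nat.add_sub_cancel]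
  refine Finset.sum_nbij (headSet (c - b))
    (fun σ _ => headSet_mem_powersetCard (Nat.sub_le c b) σ) (injOn_headSet _) ?_ fun σ hσ => ?_
  · intro S hS
    obtain ⟨hsub, hcard⟩ := Finset.mem_powersetCard.1 hS
    rw [← hcard]
    exact exists_unshuffle hsub
  · rw [sign_mul_koszulSign q hσ, sort_headSet hσ, sort_range_sdiff_headSet hσ]

end Unshuffle

/-! ### Homotopy Loday identities -/

section Loday

variable {V : Type*} [AddCommGroup V] [Module ℝ V]

lemma ofFn_val_eq_map_range {α : Type*} (n : ℕ) (v : ℕ → α) :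
    List.ofFn (fun j : Fin n => v j) = (List.range n).map v := by
  rw [List.ofFn_eq_map, ← List.map_coe_finRange_eq_range, List.map_map]
  rfl

lemma apply_ofFn (l : (k : ℕ) → MultilinearMap ℝ (fun _ : Fin k => V) V) {n : ℕ}
    (v : Fin n → V) : apply l (List.ofFn v) = l n v := by
  have hlen := List.length_ofFn (f := v)
  generalize hL : List.ofFn v = L at hlen ⊢
  subst hlen
  rw [apply, List.ofFn_injective ((List.ofFn_get L).trans hL.symm)]

lemma lodayJ_eq_sum_splitSum (l : (k : ℕ) → MultilinearMap ℝ (fun _ : Fin k => V) V) (n : ℕ)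
    (q : ℕ → ZMod 2) (v : ℕ → V) :
    lodayJ l (fun x : Fin n => q x) (fun x => v x) =
      ∑ c ∈ Finset.range n, splitSum (unshuffleExponent q) c fun S T =>
        sgn (((n - c : ℕ) : ZMod 2) * T.length + ((T.length : ZMod 2) + 1) * (S.map q).sum) •
          apply l (S.map v ++ [apply l ((T ++ [c]).map v)] ++
            ((List.range n).drop (c + 1)).map v) := by
  rw [Finset.sum_range, lodayJ]
  refine Finset.sum_congr rfl fun c _ => ?_
  rw [← sum_unshuffles]
  refine Finset.sum_congr rfl fun b hb => Finset.sum_congr rfl fun σ _ => ?_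
  have hlen : ((oneLine σ).drop (c - b)).length = b := by
    rw [List.length_drop, length_oneLine, Nat.sub_sub_self (Finset.mem_range_succ_iff.1 hb)]
  have hv : List.ofFn (fun x : Fin c => v (σ x)) = (oneLine σ).map v := by
    rw [oneLine, List.map_ofFn]
    rfl
  have hsum : (∑ x : Fin c, if (x : ℕ) < (c : ℕ) - b then q (σ x) else 0) =
      (((oneLine σ).take (c - b)).map q).sum := by
    rw [List.map_take, oneLine, List.map_ofFn, List.sum_take_ofFn, Finset.sum_filter]
    rfl
  simp only [Fin.val_castLE, hsum, hv, ofFn_val_eq_map_range, smul_smul, hlen, List.map_append,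
    List.map_cons, List.map_nil, List.map_take, List.map_drop, sgn_add, ← Nat.cast_mul,
    sgn_natCast, Nat.cast_succ, mul_assoc]

end Loday

/-! ### Parities -/

section Parity

variable {V : Type*} [AddCommGroup V] [Module ℝ V]

lemma parityInvolution_of_mem (par : ZMod 2 → Submodule ℝ V) [DirectSum.Decomposition par]
    {s : ZMod 2} {v : V} (hv : v ∈ par s) : parityInvolution par v = sgn s • v := by
  rw [parityInvolution, LinearMap.sum_apply, Finset.sum_eq_single_of_mem s (Finset.mem_univ s)]
  · exact congrArg _ (DirectSum.decompose_of_mem_same par hv)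
  · intro t _ hts
    exact (congrArg _ (DirectSum.decompose_of_mem_ne par hv hts.symm)).trans (smul_zero _)

lemma parityInvolution_pow_of_mem (par : ZMod 2 → Submodule ℝ V) [DirectSum.Decomposition par]
    {s : ZMod 2} {v : V} (hv : v ∈ par s) (k : ℕ) :
    (parityInvolution par ^ k) v = sgn ((k : ZMod 2) * s) • v := by
  induction k with
  | zero => simp
  | succ k ih =>
    rw [pow_succ, Module.End.mul_apply, parityInvolution_of_mem par hv, map_smul, ih,
      sgn_smul_smul, Nat.cast_succ, add_one_mul, add_comm]

end Parity

section Decomposition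

variable {ι κ M N : Type*} [DecidableEq ι] [DecidableEq κ] [AddCommMonoid M] [AddCommMonoid N]
  {σ τ : Type*} [SetLike σ M] [AddSubmonoidClass σ M] [SetLike τ N] [AddSubmonoidClass τ N]
  {ℳ : ι → σ} [DirectSum.Decomposition ℳ] {𝒩 : κ → τ} [DirectSum.Decomposition 𝒩]
  {f : M →+ N} {φ : ι → κ} (hφ : Function.Injective φ) (hf : ∀ i, ∀ x ∈ ℳ i, f x ∈ 𝒩 (φ i))
include hφ hf

lemma decompose_map_apply (x : M) (i : ι) :
    (DirectSum.decompose 𝒩 (f x) (φ i) : N) = f (DirectSum.decompose ℳ x i) := by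
  induction x using DirectSum.Decomposition.inductionOn ℳ with
  | zero => simp
  | add x y hx hy => simp [hx, hy]
  | @homogeneous j x =>
    obtain ⟨x, hx⟩ := x
    rcases eq_or_ne j i with rfl | hji
    · rw [DirectSum.decompose_of_mem_same 𝒩 (hf j x hx), DirectSum.decompose_of_mem_same ℳ hx]
    · rw [DirectSum.decompose_of_mem_ne 𝒩 (hf j x hx) (hφ.ne hji),
        DirectSum.decompose_of_mem_ne ℳ hx hji, map_zero]

lemma mem_of_map_mem (hinj : Function.Injective f) {x : M} {i : ι} (hx : f x ∈ 𝒩 (φ i)) :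
    x ∈ ℳ i := by
  have hcomponent : f (DirectSum.decompose ℳ x i) = f x := by
    rw [← decompose_map_apply hφ hf, DirectSum.decompose_of_mem_same 𝒩 hx]
  rw [← hinj hcomponent]
  exact SetLike.coe_mem _

end Decomposition

/-! ### Derived brackets -/

section DerivedBracket

variable {A V : Type*} [Ring A] [Algebra ℝ A] {wt : ℕ → Submodule ℝ A} [GradedAlgebra wt]
  [AddCommGroup V] [Module ℝ V]

/-- The higher derived brackets on `V` generated by `D`, for an odd isomorphism `χ` of `V` onto the
elements of weight `1`. The sign is implemented by applying the parity involution `k - i` times to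
the `i`th of `k` arguments, and only the component of weight `1` is transported to `V`. -/
noncomputable def derivedBracket (br : A →ₗ[ℝ] A →ₗ[ℝ] A) (vpar : ZMod 2 → Submodule ℝ V)
    [DirectSum.Decomposition vpar] (χ : V ≃ₗ[ℝ] wt 1) (D : A →ₗ[ℝ] A) :
    (k : ℕ) → MultilinearMap ℝ (fun _ : Fin k => V) V
  | 0 => 0
  | m + 1 => (χ.symm.toLinearMap ∘ₗ toWeightOne wt).compMultilinearMap
      ((derivedForm wt br D m).compLinearMap fun i =>
        (wt 1).subtype ∘ₗ χ.toLinearMap ∘ₗ parityInvolution vpar ^ (m - (i : ℕ)))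

variable {par : ZMod 2 → Submodule ℝ A} {br : A →ₗ[ℝ] A →ₗ[ℝ] A} {vpar : ZMod 2 → Submodule ℝ V}
  [DirectSum.Decomposition vpar]

lemma coe_derivedBracket (χ : V ≃ₗ[ℝ] wt 1) (D : A →ₗ[ℝ] A) {m : ℕ} (u : Fin (m + 1) → V) :
    (χ (derivedBracket br vpar χ D (m + 1) u) : A) =
      GradedAlgebra.proj wt 1 (derivedForm wt br D m fun i =>
        (χ ((parityInvolution vpar ^ (m - (i : ℕ))) (u i)) : A)) := by
  rw [← coe_toWeightOne]
  simp [derivedBracket]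

lemma coe_derivedBracket_of_mem (χ : V ≃ₗ[ℝ] wt 1) (D : A →ₗ[ℝ] A) {m : ℕ}
    {q : Fin (m + 1) → ZMod 2} {u : Fin (m + 1) → V} (hu : ∀ i, u i ∈ vpar (q i)) :
    (χ (derivedBracket br vpar χ D (m + 1) u) : A) = sgn (decalage (List.ofFn q)) •
      GradedAlgebra.proj wt 1 (derivedForm wt br D m fun i => (χ (u i) : A)) := by
  rw [coe_derivedBracket, decalage_ofFn, sgn_sum, ← map_smul, ← MultilinearMap.map_smul_univ]
  congr 2
  ext i
  rw [parityInvolution_pow_of_mem vpar (hu i), map_smul]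
  rfl

variable {ι : Type*} {u : ι → V} {q : ι → ZMod 2} {L : List ι}

lemma derivedBracket_zero (χ : V ≃ₗ[ℝ] wt 1) (k : ℕ) : derivedBracket br vpar χ 0 k = 0 := by
  cases k with
  | zero => rfl
  | succ m =>
    have hnested : ∀ m, nested br 0 m = 0 := fun m => by
      induction m with
      | zero => ext; simp [nested]
      | succ m ih => ext; simp [nested, ih]
    have hform : derivedForm wt br 0 m = 0 := by
      cases m <;> ext <;> simp [derivedForm, hnested]
    ext
    simp [derivedBracket, hform]

section Poisson

variable (h : IsWeightTwoPoisson wt par br) (χ : V ≃ₗ[ℝ] wt 1)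
include h

lemma coe_apply_derivedBracket_cons (D : A →ₗ[ℝ] A) {i : ι}
    (hL : ∀ j ∈ i :: L, u j ∈ vpar (q j)) :
    (χ (apply (derivedBracket br vpar χ D) ((i :: L).map u)) : A) =
      sgn (decalage ((i :: L).map q)) •
        GradedAlgebra.proj wt 1 (iteratedBr br (fun j => (χ (u j) : A)) L (D (χ (u i)))) := by
  have htail : List.ofFn (Fin.tail (i :: L).get) = L := List.ofFn_get L
  rw [← List.ofFn_getElem_eq_map (i :: L) u, ← List.ofFn_getElem_eq_map (i :: L) q, apply_ofFn]
  refine (coe_derivedBracket_of_mem χ D fun j => hL _ (List.getElem_mem _)).trans ?_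
  rw [proj_one_derivedForm h D _ fun j => SetLike.coe_mem _]
  refine congrArg (fun x => _ • GradedAlgebra.proj wt 1 x) ?_
  refine (nested_eq_iteratedBr D _ (fun j => (χ (u j) : A)) (i :: L).get).trans ?_
  rw [htail]
  rfl

lemma coe_apply_derivedBracket (θ : A) (hne : L ≠ []) (hL : ∀ j ∈ L, u j ∈ vpar (q j)) :
    (χ (apply (derivedBracket br vpar χ (br θ)) (L.map u)) : A) = sgn (decalage (L.map q)) •
      GradedAlgebra.proj wt 1 (iteratedBr br (fun j => (χ (u j) : A)) L θ) := by
  cases L with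
  | nil => exact absurd rfl hne
  | cons i L => exact coe_apply_derivedBracket_cons h χ (br θ) hL

lemma coe_derivedBracket_two (θ : A) {s : ZMod 2} {v w : V} (hv : v ∈ vpar s) :
    (χ (derivedBracket br vpar χ (br θ) 2 ![v, w]) : A) =
      sgn s • br (br (GradedAlgebra.proj wt 3 θ) (χ v)) (χ w) := by
  rw [coe_derivedBracket, proj_one_derivedForm h _ _ fun j => SetLike.coe_mem _]
  simp [nested, Fin.init, parityInvolution_of_mem vpar hv, h.proj_br_of_mem_one]

lemma coe_derivedBracket_eq_derivedForm {D : A →ₗ[ℝ] A}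
    (hD : ∀ b ∈ wt 1, GradedAlgebra.proj wt 0 (D b) = 0) {m : ℕ} {q : Fin (m + 1) → ZMod 2}
    {u : Fin (m + 1) → V} (hu : ∀ i, u i ∈ vpar (q i)) :
    (χ (derivedBracket br vpar χ D (m + 1) u) : A) =
      sgn (∑ i : Fin (m + 1), ((m - (i : ℕ) : ℕ) : ZMod 2) * q i) •
        derivedForm wt br D m fun i => (χ (u i) : A) := by
  rw [coe_derivedBracket_of_mem χ D hu, decalage_ofFn, proj_one_derivedForm h _ _
    fun j => SetLike.coe_mem _, derivedForm_eq_proj_one h hD _ fun j => SetLike.coe_mem _]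

variable [DirectSum.Decomposition par]
  (hproj : ∀ k s f, f ∈ par s → GradedAlgebra.proj wt k f ∈ par s) {χ}
  (hχ : ∀ s v, v ∈ vpar s → (χ v : A) ∈ par (s + 1)) {θ : A} (hθ : θ ∈ par 1)
include hproj hχ hθ

lemma apply_derivedBracket_mem (hne : L ≠ []) (hL : ∀ j ∈ L, u j ∈ vpar (q j)) :
    apply (derivedBracket br vpar χ (br θ)) (L.map u) ∈
      vpar ((L.length : ZMod 2) + (L.map q).sum) := by
  refine mem_of_map_mem (f := ((wt 1).subtype ∘ₗ χ.toLinearMap).toAddMonoidHom)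
    (add_left_injective 1) hχ (Subtype.val_injective.comp χ.injective) ?_
  change (χ _ : A) ∈ _
  rw [coe_apply_derivedBracket h χ θ hne hL]
  refine Submodule.smul_mem _ _ (hproj _ _ _ ?_)
  rw [add_comm, add_comm (L.length : ZMod 2), ← sum_map_add_one]
  exact iteratedBr_mem_par h (fun j hj => hχ _ _ (hL j hj)) hθ

lemma derivedBracket_mem {k : ℕ} (hk : 1 ≤ k) {q : Fin k → ZMod 2} {u : Fin k → V}
    (hu : ∀ i, u i ∈ vpar (q i)) :
    derivedBracket br vpar χ (br θ) k u ∈ vpar ((k : ZMod 2) + ∑ i, q i) := by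
  have hmem := apply_derivedBracket_mem h hproj hχ hθ (L := List.finRange k)
    (by simpa using Nat.one_le_iff_ne_zero.1 hk) fun i _ => hu i
  rwa [← List.ofFn_eq_map, ← List.ofFn_eq_map, apply_ofFn, List.length_finRange,
    List.sum_ofFn] at hmem

lemma coe_apply_derivedBracket_comp {S T R : List ι} (hT : T ≠ [])
    (hu : ∀ j, u j ∈ vpar (q j)) :
    (χ (apply (derivedBracket br vpar χ (br θ)) (S.map u ++
      [apply (derivedBracket br vpar χ (br θ)) (T.map u)] ++ R.map u)) : A) =
    sgn (decalage (S.map q ++ [(T.length : ZMod 2) + (T.map q).sum] ++ R.map q) +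
        decalage (T.map q)) •
      GradedAlgebra.proj wt 1 (iteratedBr br (fun j => (χ (u j) : A)) R
        (br (iteratedBr br (fun j => (χ (u j) : A)) S θ)
          (GradedAlgebra.proj wt 1 (iteratedBr br (fun j => (χ (u j) : A)) T θ)))) := by
  have hinner := apply_derivedBracket_mem h hproj hχ hθ hT fun j _ => hu j
  have houter := coe_apply_derivedBracket h χ θ
    (L := S.map some ++ [none] ++ R.map some)
    (u := fun j => j.elim (apply (derivedBracket br vpar χ (br θ)) (T.map u)) u)
    (q := fun j => j.elim ((T.length : ZMod 2) + (T.map q).sum) q) (by simp) fun j _ => by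
      cases j with
      | none => exact hinner
      | some j => exact hu j
  simp only [List.map_append, List.map_map, List.map_cons, List.map_nil, Function.comp_def,
    Option.elim_some, Option.elim_none, iteratedBr_append, iteratedBr_map, iteratedBr_cons,
    iteratedBr_nil] at houter
  rw [houter, coe_apply_derivedBracket h χ θ hT fun j _ => hu j, map_smul, map_smul, map_smul,
    sgn_smul_smul]

lemma coe_apply_derivedBracket_range {q : ℕ → ZMod 2} {u : ℕ → V} (hu : ∀ j, u j ∈ vpar (q j))
    {n c : ℕ} (hc : c < n) {S T : List ℕ} (hST : (S ++ T).Perm (List.range c)) :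
    sgn (((n - c : ℕ) : ZMod 2) * T.length + ((T.length : ZMod 2) + 1) * (S.map q).sum) •
      (χ (apply (derivedBracket br vpar χ (br θ)) (S.map u ++
        [apply (derivedBracket br vpar χ (br θ)) ((T ++ [c]).map u)] ++
          ((List.range n).drop (c + 1)).map u)) : A) =
    sgn (decalage ((List.range c).map q) + decalage (S.map q) + decalage (T.map q) +
        ((T.length : ZMod 2) + 1) * (S.map q).sum + (S.length : ZMod 2)) •
      sgn ((n : ZMod 2) + 1 + decalage ((List.range n).map q)) •
        GradedAlgebra.proj wt 1 (iteratedBr br (fun j => (χ (u j) : A))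
          ((List.range n).drop (c + 1)) (br (iteratedBr br (fun j => (χ (u j) : A)) S θ)
            (GradedAlgebra.proj wt 1 (iteratedBr br (fun j => (χ (u j) : A)) (T ++ [c]) θ)))) := by
  have htake : List.range c ++ [c] = (List.range n).take (c + 1) := by
    rw [List.take_range, min_eq_left hc, List.range_succ]
  have hsplit : (List.range c).map q ++ [q c] ++ ((List.range n).drop (c + 1)).map q =
      (List.range n).map q := by
    rw [← List.map_singleton, ← List.map_append, ← List.map_append, htake, List.take_append_drop]
  have hsub : n - c = ((List.range n).drop (c + 1)).length + 1 := by
    rw [List.length_drop, List.length_range]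
    omega
  have hlen : ((List.range c).map q).length = (S.map q).length + (T.map q).length := by
    rw [← (hST.map q).length_eq, List.map_append, List.length_append]
  have hsum : ((List.range c).map q).sum = (S.map q).sum + (T.map q).sum := by
    rw [← (hST.map q).sum_eq, List.map_append, List.sum_append]
  have hsign := decalage_composition hlen hsum (q c) (((List.range n).drop (c + 1)).map q)
  rw [hsplit] at hsign
  simp only [List.length_map, List.length_range] at hsign
  rw [coe_apply_derivedBracket_comp h hproj hχ hθ (by simp) hu, sgn_smul_smul, sgn_smul_smul, hsub]
  congr 2
  simpa [add_assoc] using hsign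

lemma coe_lodayJ_derivedBracket {q : ℕ → ZMod 2} {u : ℕ → V} (hu : ∀ j, u j ∈ vpar (q j))
    (n : ℕ) :
    (χ (lodayJ (derivedBracket br vpar χ (br θ)) (fun x : Fin n => q x) (fun x => u x)) : A) =
    sgn ((n : ZMod 2) + 1 + decalage ((List.range n).map q)) • GradedAlgebra.proj wt 1
      (∑ c ∈ Finset.range n, iteratedBr br (fun j => (χ (u j) : A)) ((List.range n).drop (c + 1))
        (splitSum (bracketExponent fun j => q j + 1) c fun S T =>
          br (iteratedBr br (fun j => (χ (u j) : A)) S θ)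
            (GradedAlgebra.proj wt 1
              (iteratedBr br (fun j => (χ (u j) : A)) (T ++ [c]) θ)))) := by
  change ((wt 1).subtype ∘ₗ χ.toLinearMap) _ = _
  rw [lodayJ_eq_sum_splitSum, map_sum, map_sum, Finset.smul_sum]
  refine Finset.sum_congr rfl fun c hc => ?_
  rw [map_splitSum, map_splitSum, map_splitSum, smul_splitSum, ← splitSum_unshuffleExponent]
  refine splitSum_congr _ _ fun S T hST => (map_smul _ _ _).trans ?_
  exact coe_apply_derivedBracket_range h hproj hχ hθ hu (Finset.mem_range.1 hc) hST

variable (hP : projP wt θ = 0)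
include hP

lemma lodayJ_derivedBracket {m : ℕ} {q : Fin (m + 1) → ZMod 2} {u : Fin (m + 1) → V}
    (hu : ∀ j, u j ∈ vpar (q j)) :
    lodayJ (derivedBracket br vpar χ (br θ)) q u =
      (-1 : ℝ) ^ (m + 1 + 1) • derivedBracket br vpar χ (br θ ∘ₗ br θ) (m + 1) u := by
  suffices hseq : ∀ {q : ℕ → ZMod 2} {u : ℕ → V}, (∀ j, u j ∈ vpar (q j)) →
      lodayJ (derivedBracket br vpar χ (br θ)) (fun j : Fin (m + 1) => q j) (fun j => u j) =
        (-1 : ℝ) ^ (m + 1 + 1) •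
          derivedBracket br vpar χ (br θ ∘ₗ br θ) (m + 1) (fun j => u j) by
    simpa only [Fin.ofNat_val_eq_self] using hseq (q := fun j => q (Fin.ofNat (m + 1) j))
      (u := fun j => u (Fin.ofNat (m + 1) j)) fun j => hu _
  intro q u hu
  have hcons : List.range (m + 1) = 0 :: (List.range (m + 1)).drop 1 := by
    rw [List.range_eq_range', List.range'_succ, List.drop_one, List.tail_cons]
  have hsquare := coe_apply_derivedBracket_cons h χ (br θ ∘ₗ br θ) (i := 0)
    (L := (List.range (m + 1)).drop 1) fun j _ => hu j
  rw [← hcons, ← ofFn_val_eq_map_range, apply_ofFn] at hsquare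
  refine χ.injective (Subtype.ext ?_)
  rw [coe_lodayJ_derivedBracket h hproj hχ hθ hu, proj_one_sum_iteratedBr_splitSum h hθ
    (fun j => hχ _ _ (hu j)) hproj (fun j => SetLike.coe_mem _) hP, map_smul, Submodule.coe_smul,
    hsquare, sgn_add, mul_smul, ← Nat.cast_succ, sgn_natCast]
  rfl

end Poisson

end DerivedBracket

namespace Sections

variable {p : ℕ} {X : Type*} [TopologicalSpace X] [ChartedSpace (EuclideanSpace ℝ (Fin p)) X]
  {𝓜 : SymplecticTwoManifold p X}

lemma dorfman_eq_derivedBracket (E : Sections 𝓜) (D : 𝓜.A →ₗ[ℝ] 𝓜.A) :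
    E.dorfman D = derivedBracket 𝓜.bracket E.par E.χ D := by
  ext k : 1
  cases k <;> rfl

end Sections

end HigherDorfman

open HigherDorfman in
theorem mainTheorem1_general {A V : Type*} [Ring A] [Algebra ℝ A] {wt : ℕ → Submodule ℝ A}
    [GradedAlgebra wt] {par : ZMod 2 → Submodule ℝ A} [DirectSum.Decomposition par]
    {br : A →ₗ[ℝ] A →ₗ[ℝ] A} (h : IsWeightTwoPoisson wt par br)
    (hproj : ∀ k s f, f ∈ par s → GradedAlgebra.proj wt k f ∈ par s)
    [AddCommGroup V] [Module ℝ V] {vpar : ZMod 2 → Submodule ℝ V} [DirectSum.Decomposition vpar]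
    {χ : V ≃ₗ[ℝ] wt 1} (hχ : ∀ s v, v ∈ vpar s → (χ v : A) ∈ par (s + 1))
    {θ : A} (hθ : θ ∈ par 1) (hP : projP wt θ = 0) :
    (∀ (m : ℕ) (q : Fin (m + 1) → ZMod 2) (u : Fin (m + 1) → V), (∀ i, u i ∈ vpar (q i)) →
      (χ (derivedBracket br vpar χ (br θ) (m + 1) u) : A) =
        sgn (∑ i : Fin (m + 1), ((m - (i : ℕ) : ℕ) : ZMod 2) * q i) •
          derivedForm wt br (br θ) m (fun i => (χ (u i) : A)) ∧
      (χ (derivedBracket br vpar χ (br θ ∘ₗ br θ) (m + 1) u) : A) =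
        sgn (∑ i : Fin (m + 1), ((m - (i : ℕ) : ℕ) : ZMod 2) * q i) •
          derivedForm wt br (br θ ∘ₗ br θ) m (fun i => (χ (u i) : A))) ∧
    (∀ (n : ℕ), 1 ≤ n → ∀ (q : Fin n → ZMod 2) (u : Fin n → V), (∀ i, u i ∈ vpar (q i)) →
      lodayJ (derivedBracket br vpar χ (br θ)) q u =
        (-1 : ℝ) ^ (n + 1) • derivedBracket br vpar χ (br θ ∘ₗ br θ) n u) ∧
    (br θ ∘ₗ br θ = 0 → IsHomotopyLoday vpar (derivedBracket br vpar χ (br θ))) ∧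
    ∀ (s : ZMod 2) (v w : V), v ∈ vpar s →
      (χ (derivedBracket br vpar χ (br θ) 2 ![v, w]) : A) =
        sgn s • br (br (GradedAlgebra.proj wt 3 θ) (χ v)) (χ w) := by
  have hJ : ∀ (n : ℕ), 1 ≤ n → ∀ (q : Fin n → ZMod 2) (u : Fin n → V),
      (∀ i, u i ∈ vpar (q i)) → lodayJ (derivedBracket br vpar χ (br θ)) q u =
        (-1 : ℝ) ^ (n + 1) • derivedBracket br vpar χ (br θ ∘ₗ br θ) n u := by
    intro n hn q u hu
    obtain ⟨m, rfl⟩ := Nat.exists_eq_add_of_le' hn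
    exact lodayJ_derivedBracket h hproj hχ hθ hP hu
  have hθ_one : GradedAlgebra.proj wt 1 θ = 0 := by
    simpa [hP] using (proj_projP (wt := wt) 1 θ).symm
  refine ⟨fun m q u hu => ⟨?_, ?_⟩, hJ, fun hQ => ⟨?_, ?_⟩, fun s v w hv => ?_⟩
  · exact coe_derivedBracket_eq_derivedForm h χ
      (fun b hb => h.proj_zero_br_of_mem_one hθ_one hb) hu
  · exact coe_derivedBracket_eq_derivedForm h χ
      (fun b hb => h.proj_zero_br_br_of_mem_one hP hb) hu
  · exact fun k hk q u hu => derivedBracket_mem h hproj hχ hθ hk hu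
  · intro n hn q u hu
    rw [hJ n hn q u hu, hQ, derivedBracket_zero, zero_apply, smul_zero]
  · exact coe_derivedBracket_two h χ θ hv

theorem mainTheorem1 {p : ℕ} {X : Type*} [TopologicalSpace X]
    [ChartedSpace (EuclideanSpace ℝ (Fin p)) X] [IsManifold (𝓡 p) ∞ X]
    [T2Space X] [SecondCountableTopology X]
    (𝓜 : HigherDorfman.SymplecticTwoManifold p X) (E : HigherDorfman.Sections 𝓜)
    (θ : 𝓜.A) (hθ_odd : θ ∈ 𝓜.Par 1) (hθ_P : 𝓜.P θ = 0)
    (Q : 𝓜.A →ₗ[ℝ] 𝓜.A) (hQ : Q = 𝓜.bracket θ) :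
    -- the brackets generated by `Q` and by `Q²` are given by the derived bracket formula
    (∀ (m : ℕ) (q : Fin (m + 1) → ZMod 2) (u : Fin (m + 1) → E.V), (∀ i, u i ∈ E.par (q i)) →
      (E.χ (E.dorfman Q (m + 1) u) : 𝓜.A) = E.derivedFormula Q q u ∧
      (E.χ (E.dorfman (Q ∘ₗ Q) (m + 1) u) : 𝓜.A) = E.derivedFormula (Q ∘ₗ Q) q u) ∧
    -- `Jₙ` is, up to sign, the `n`th bracket generated by `Q²`
    (∀ (n : ℕ), 1 ≤ n → ∀ (q : Fin n → ZMod 2) (u : Fin n → E.V), (∀ i, u i ∈ E.par (q i)) →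
      HigherDorfman.lodayJ (E.dorfman Q) q u =
        (-1 : ℝ) ^ (n + 1) • E.dorfman (Q ∘ₗ Q) n u) ∧
    -- if `Q² = 0`, the brackets form a homotopy Loday algebra
    (Q ∘ₗ Q = 0 → HigherDorfman.IsHomotopyLoday E.par (E.dorfman Q)) ∧
    -- the binary bracket is the Dorfman bracket of the component of weight 3 of `θ`
    E.IsDorfmanBracket (GradedAlgebra.proj (𝓜.wt ⊤) 3 θ) (fun u v => E.dorfman Q 2 ![u, v]) := by
  subst hQ
  simp only [E.dorfman_eq_derivedBracket]
  obtain ⟨hformula, hJ, hLoday, hbinary⟩ := mainTheorem1_general (𝓜.poisson ⊤)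
    (𝓜.super ⊤).proj_mem_par E.χ_odd hθ_odd hθ_P
  exact ⟨hformula, hJ, hLoday, HigherDorfman.proj_mem 3 θ, hbinary⟩
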